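/- Let $\mathcal H_A,\mathcal H_B$ be finite-dimensional complex Hilbert spaces, let $\Phi,\Psi\in\mathcal H_A\otimes\mathcal H_B$ be unit vectors, and let $\rho=\mathrm{Tr}_B|\Phi\rangle\langle\Phi|$ and $\sigma=\mathrm{Tr}_B|\Psi\rangle\langle\Psi|$ be their reduced densities on $\mathcal H_A$. For density operators $\rho',\rho$ on $\mathcal H_A$ write $\rho'\succeq\rho$ if for every $k$ the sum of the $k$ largest eigenvalues (counted with multiplicity) of $\rho'$ is at least the sum of the $k$ largest eigenvalues of $\rho$. Call a quantum operation LOCC if it can be implemented by finitely many rounds in which one of the two parties performs a local quantum instrument with finitely many outcomes and announces the outcome, all later steps being allowed to depend on the announced outcomes. Then all of the following maxima exist, and $$\max_{C}\langle\Psi|C(|\Phi\rangle\langle\Phi|)|\Psi\rangle=\max_{\rho'\succeq\rho}\ \max_{U}\bigl|\mathrm{Tr}\,\sqrt{\rho'}\sqrt{\sigma}\,U\bigr|^2,$$ where $C$ runs over all LOCC operations on $\mathcal H_A\otimes\mathcal H_B$, $\rho'$ over the density operators on $\mathcal H_A$ with $\rho'\succeq\rho$, and $U$ over the unitary operators on $\mathcal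 H_A$. If moreover $\Psi$ is maximally entangled of size $L\ge1$, i.e. $T:=L\sigma$ is an orthogonal projection of rank $L$, then $$\max_{\rho'\succeq\rho}\ \max_{U}\bigl|\mathrm{Tr}\,\sqrt{\rho'}\sqrt{\sigma}\,U\bigr|^2=\max_{\rho'\succeq\rho}\frac{\bigl(\mathrm{Tr}\,\sqrt{\rho'}\,T\bigr)^2}{L}.$$ -/

import Mathlib

open scoped Matrix Kronecker ComplexOrder MatrixOrder

noncomputable section

namespace LOCCFidelity

/-- Operators on `ℂ^a ⊗ ℂ^b`, the joint system of Alice (first factor) and Bob (second factor). -/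
abbrev BipOp (a b : ℕ) : Type := Matrix (Fin a × Fin b) (Fin a × Fin b) ℂ

/-- Vectors of the Hilbert space `ℂ^a ⊗ ℂ^b`. -/
abbrev BipVec (a b : ℕ) : Type := EuclideanSpace ℂ (Fin a × Fin b)

/-- The operator `|Φ⟩⟨Φ|`. -/
def pureState {a b : ℕ} (Φ : BipVec a b) : BipOp a b :=
  Matrix.vecMulVec (fun x => Φ x) (fun x => star (Φ x))

/-- The partial trace over Bob's system. -/
def partialTraceB {a b : ℕ} (X : BipOp a b) : Matrix (Fin a) (Fin a) ℂ :=
  Matrix.of fun i i' => ∑ j, X (i, j) (i', j)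

/-- The reduced density `Tr_B |Φ⟩⟨Φ|`. -/
def reducedDensity {a b : ℕ} (Φ : BipVec a b) : Matrix (Fin a) (Fin a) ℂ :=
  partialTraceB (pureState Φ)

/-- The completely positive map on Alice's system with Kraus operators `K j`,
tensored with the identity on Bob's system. -/
def aliceMap {a b e l : ℕ} (K : Fin l → Matrix (Fin e) (Fin a) ℂ) (X : BipOp a b) : BipOp e b :=
  ∑ j, (K j ⊗ₖ (1 : Matrix (Fin b) (Fin b) ℂ)) * X * (K j ⊗ₖ (1 : Matrix (Fin b) (Fin b) ℂ))ᴴ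

/-- The completely positive map on Bob's system with Kraus operators `K j`,
tensored with the identity on Alice's system. -/
def bobMap {a b e l : ℕ} (K : Fin l → Matrix (Fin e) (Fin b) ℂ) (X : BipOp a b) : BipOp a e :=
  ∑ j, ((1 : Matrix (Fin a) (Fin a) ℂ) ⊗ₖ K j) * X * ((1 : Matrix (Fin a) (Fin a) ℂ) ⊗ₖ K j)ᴴ

/-- Quantum operations implementable by local operations and classical communication, with any
finite number of rounds: either nothing is done, or one party performs a local instrument (a finite
family of completely positive maps, the `k`-th with Kraus operators `K k j`, whose sum preserves
the trace), announces the outcome `k`, and the parties go on with an LOCC operation `C k` depending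
on `k`. The local dimensions may change at every step, so local ancillas may be added and
discarded. -/
inductive IsLOCC {a' b' : ℕ} : {a b : ℕ} → (BipOp a b → BipOp a' b') → Prop
  | refl : IsLOCC (a := a') (b := b') (fun X => X)
  | alice {a b m l : ℕ} (e : Fin m → ℕ)
      (K : (k : Fin m) → Fin l → Matrix (Fin (e k)) (Fin a) ℂ)
      (hK : ∑ k, ∑ j, (K k j)ᴴ * K k j = 1)
      (C : (k : Fin m) → BipOp (e k) b → BipOp a' b')
      (hC : ∀ k, IsLOCC (C k)) :
      IsLOCC (fun X : BipOp a b => ∑ k, C k (aliceMap (K k) X))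
  | bob {a b m l : ℕ} (e : Fin m → ℕ)
      (K : (k : Fin m) → Fin l → Matrix (Fin (e k)) (Fin b) ℂ)
      (hK : ∑ k, ∑ j, (K k j)ᴴ * K k j = 1)
      (C : (k : Fin m) → BipOp a (e k) → BipOp a' b')
      (hC : ∀ k, IsLOCC (C k)) :
      IsLOCC (fun X : BipOp a b => ∑ k, C k (bobMap (K k) X))

/-- The fidelity `⟨Ψ| X |Ψ⟩` (a real number for Hermitian `X`). -/
def fidelity {a b : ℕ} (Ψ : BipVec a b) (X : BipOp a b) : ℝ :=
  ((fun x => star (Ψ x)) ⬝ᵥ (X *ᵥ (fun x => Ψ x))).re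

/-- Density matrices. -/
def IsDensity {d : ℕ} (ρ : Matrix (Fin d) (Fin d) ℂ) : Prop :=
  ρ.PosSemidef ∧ ρ.trace = 1

/-- `ρ' ⪰ ρ`: for every `k`, the sum of the `k` largest eigenvalues (with multiplicity) of `ρ'` is
at least that of `ρ`. Mathlib's `eigenvalues₀` lists the eigenvalues in decreasing order. -/
def Majorizes {d : ℕ} (ρ' ρ : Matrix (Fin d) (Fin d) ℂ) : Prop :=
  ∃ (h' : ρ'.IsHermitian) (h : ρ.IsHermitian), ∀ k : ℕ,
    ∑ i with i.val < k, h.eigenvalues₀ i ≤ ∑ i with i.val < k, h'.eigenvalues₀ i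

/-- The set of density matrices `ρ'` with `ρ' ⪰ ρ`. -/
def majorizingDensities {d : ℕ} (ρ : Matrix (Fin d) (Fin d) ℂ) : Set (Matrix (Fin d) (Fin d) ℂ) :=
  {ρ' | IsDensity ρ' ∧ Majorizes ρ' ρ}

/-- `Ψ` is maximally entangled of size `L ≥ 1`: `L • Tr_B |Ψ⟩⟨Ψ|` is an orthogonal projection of
rank `L`. -/
def IsMaximallyEntangled {a b : ℕ} (Ψ : BipVec a b) (L : ℕ) : Prop :=
  0 < L ∧ IsStarProjection ((L : ℂ) • reducedDensity Ψ) ∧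
    ((L : ℂ) • reducedDensity Ψ).rank = L

end LOCCFidelity

end

noncomputable section

namespace LOCCFidelity

/-- Abel summation: weighting by an antitone nonnegative function preserves domination of partial
sums. -/
theorem sum_mul_le_sum_mul_of_partialSums_le {n : ℕ} {x y z : Fin n → ℝ} (hx : Antitone x)
    (hx0 : ∀ i, 0 ≤ x i)
    (h : ∀ k : ℕ, ∑ i with i.val < k, z i ≤ ∑ i with i.val < k, y i) :
    ∑ i, x i * z i ≤ ∑ i, x i * y i := by
  set X : ℕ → ℝ := fun k => if hk : k < n then x ⟨k, hk⟩ else 0 with hX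
  have hXa : ∀ k, X (k + 1) ≤ X k := by
    intro k
    simp only [hX]
    split_ifs with h1 h2 h2
    · exact hx (by simp)
    · omega
    · exact hx0 _
    · exact le_rfl
  have hxX : ∀ i : Fin n, x i = ∑ k ∈ Finset.range n, if i.val < k + 1 then X k - X (k + 1) else 0 := by
    intro i
    rw [← Finset.sum_filter]
    have : (Finset.range n).filter (fun k => i.val < k + 1) = Finset.Ico i.val n := by
      ext k; simp; omega
    rw [this, Finset.sum_Ico_eq_sub _ i.2.le, Finset.sum_range_sub', Finset.sum_range_sub']
    simp [hX]
  have key : ∀ w : Fin n → ℝ, ∑ i, x i * w i =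
      ∑ k ∈ Finset.range n, (X k - X (k + 1)) * ∑ i with i.val < k + 1, w i := by
    intro w
    simp_rw [Finset.mul_sum, Finset.sum_filter]
    rw [Finset.sum_comm]
    refine Finset.sum_congr rfl fun i _ => ?_
    rw [hxX i, Finset.sum_mul]
    refine Finset.sum_congr rfl fun k _ => ?_
    split_ifs <;> simp
  rw [key, key]
  exact Finset.sum_le_sum fun k _ => mul_le_mul_of_nonneg_left (h _) (by linarith [hXa k])

/-- Abel summation for a multiplier of arbitrary sign, under equality of the total sums. -/
theorem sum_mul_le_sum_mul_of_majorized {n : ℕ} {x y z : Fin n → ℝ} (hx : Antitone x)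
    (h : ∀ k : ℕ, ∑ i with i.val < k, z i ≤ ∑ i with i.val < k, y i)
    (hsum : ∑ i, z i = ∑ i, y i) :
    ∑ i, x i * z i ≤ ∑ i, x i * y i := by
  obtain ⟨c, hc⟩ : ∃ c, ∀ i, c ≤ x i := by
    obtain ⟨c, hc⟩ := (Set.finite_range x).bddBelow
    exact ⟨c, fun i => hc ⟨i, rfl⟩⟩
  have := sum_mul_le_sum_mul_of_partialSums_le (x := fun i => x i - c)
    (fun i j hij => sub_le_sub_right (hx hij) c) (fun i => sub_nonneg.2 (hc i)) h
  simp only [sub_mul, Finset.sum_sub_distrib, ← Finset.mul_sum, hsum] at this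
  linarith

theorem card_filter_val_lt_le (n k : ℕ) :
    (Finset.univ.filter fun i : Fin n => i.val < k).card ≤ k := by
  calc _ = ((Finset.univ.filter fun i : Fin n => i.val < k).map Fin.valEmbedding).card := by simp
    _ ≤ (Finset.range k).card := Finset.card_le_card (by
        intro i; simp; omega)
    _ = k := by simp

theorem antitone_indicator_val_lt (n k : ℕ) :
    Antitone fun i : Fin n => if i.val < k then (1 : ℝ) else 0 := by
  intro i j hij
  have : i.val ≤ j.val := hij
  dsimp only
  split_ifs <;> first | omega | norm_num

/-- A doubly substochastic matrix does not increase the pairing of two antitone nonnegative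
vectors. -/
theorem sum_mul_substochastic_le {n : ℕ} {x y : Fin n → ℝ} (hx : Antitone x) (hx0 : ∀ i, 0 ≤ x i)
    (hy : Antitone y) (hy0 : ∀ i, 0 ≤ y i) {B : Fin n → Fin n → ℝ} (hB : ∀ i j, 0 ≤ B i j)
    (hrow : ∀ i, ∑ j, B i j ≤ 1) (hcol : ∀ j, ∑ i, B i j ≤ 1) :
    ∑ i, ∑ j, x i * B i j * y j ≤ ∑ i, x i * y i := by
  have hsub : ∀ (s : Finset (Fin n)) j, ∑ i ∈ s, B i j ≤ 1 := fun s j =>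
    (Finset.sum_le_univ_sum_of_nonneg fun i => hB i j).trans (hcol j)
  have hsub' : ∀ (s : Finset (Fin n)) i, ∑ j ∈ s, B i j ≤ 1 := fun s i =>
    (Finset.sum_le_univ_sum_of_nonneg fun j => hB i j).trans (hrow i)
  have step : ∀ k : ℕ, ∑ i with i.val < k, ∑ j, B i j * y j ≤ ∑ i with i.val < k, y i := by
    intro k
    have h1 : ∑ i with i.val < k, ∑ j, B i j * y j = ∑ j, y j * ∑ i with i.val < k, B i j := by
      rw [Finset.sum_comm]
      simp_rw [Finset.mul_sum, mul_comm]
    have h2 : ∑ i with i.val < k, y i = ∑ j, y j * (if j.val < k then 1 else 0) := by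
      simp [Finset.sum_filter]
    rw [h1, h2]
    refine sum_mul_le_sum_mul_of_partialSums_le hy hy0 fun l => ?_
    have h3 : ∑ j : Fin n with j.val < l, (if j.val < k then (1 : ℝ) else 0) =
        ((Finset.univ.filter fun j : Fin n => j.val < min l k).card : ℝ) := by
      rw [← Finset.sum_filter, Finset.filter_filter]
      simp
    rw [h3]
    rcases le_total l k with hlk | hlk
    · rw [min_eq_left hlk]
      calc _ ≤ ∑ j : Fin n with j.val < l, (1 : ℝ) := Finset.sum_le_sum fun j _ => hsub _ j
        _ = _ := by simp
    · rw [min_eq_right hlk, Finset.sum_comm]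
      calc _ ≤ ∑ j : Fin n with j.val < k, (1 : ℝ) := Finset.sum_le_sum fun j _ => hsub' _ j
        _ = _ := by simp
  calc _ = ∑ i, x i * ∑ j, B i j * y j := by simp_rw [Finset.mul_sum, mul_assoc]
    _ ≤ _ := sum_mul_le_sum_mul_of_partialSums_le hx hx0 step

/-- Rado's theorem: a vector majorized by `p` is a convex combination of permutations of `p`. -/
theorem exists_convex_combination_perm {n : ℕ} {p q : Fin n → ℝ} (hq : Antitone q)
    (h : ∀ k : ℕ, ∑ i with i.val < k, q i ≤ ∑ i with i.val < k, p i)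
    (hsum : ∑ i, q i = ∑ i, p i) :
    ∃ (m : ℕ) (t : Fin m → ℝ) (π : Fin m → Equiv.Perm (Fin n)), (∀ j, 0 ≤ t j) ∧ ∑ j, t j = 1 ∧
      ∀ i, q i = ∑ j, t j * p (π j i) := by
  set S : Set (Fin n → ℝ) := Set.range fun π : Equiv.Perm (Fin n) => p ∘ π
  have hmem : q ∈ convexHull ℝ S := by
    by_contra hn
    obtain ⟨f, u, hfu, hu⟩ := geometric_hahn_banach_closed_point (convex_convexHull ℝ S)
      ((Set.finite_range _).isClosed_convexHull ℝ) hn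
    set c : Fin n → ℝ := fun i => f (Pi.single i 1)
    have hf : ∀ v : Fin n → ℝ, f v = ∑ i, c i * v i := by
      intro v
      conv_lhs => rw [pi_eq_sum_univ' v, map_sum]
      refine Finset.sum_congr rfl fun i _ => ?_
      rw [map_smul, smul_eq_mul, mul_comm]
    set τ : Equiv.Perm (Fin n) := Tuple.sort (fun i => -c i)
    have hτ : Antitone (c ∘ τ) := by
      intro i j hij
      have := Tuple.monotone_sort (fun i => -c i) hij
      simpa using this
    have h1 : f q ≤ ∑ i, c (τ i) * q i := by
      have hm : Monovary (c ∘ τ) q := hτ.monovary hq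
      have := hm.sum_mul_comp_perm_le_sum_mul (σ := τ)
      rw [hf, ← Equiv.sum_comp τ]
      simpa using this
    have h2 : ∑ i, c (τ i) * q i ≤ ∑ i, c (τ i) * p i :=
      sum_mul_le_sum_mul_of_majorized hτ h hsum
    have h3 : f (p ∘ τ.symm) = ∑ i, c (τ i) * p i := by
      rw [hf, ← Equiv.sum_comp τ]; simp
    have h4 := hfu (p ∘ τ.symm) (subset_convexHull ℝ S ⟨τ.symm, rfl⟩)
    linarith
  rw [mem_convexHull_iff_exists_fintype] at hmem
  obtain ⟨ι, _, w, z, hw0, hw1, hz, hx⟩ := hmem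
  choose π hπ using hz
  let e := (Fintype.equivFin ι).symm
  refine ⟨Fintype.card ι, w ∘ e, π ∘ e, fun j => hw0 _, ?_, fun i => ?_⟩
  · rw [← hw1]; exact Equiv.sum_comp e w
  · rw [← hx]
    have := Equiv.sum_comp e (fun j => w j * p (π j i))
    simp only [Function.comp_apply]
    rw [this]
    simp [← hπ]

/-- Superadditivity of `p ↦ (∑ √pᵢ rᵢ)²` over finite families. -/
theorem sum_sq_sum_sqrt_mul_le {ι κ : Type*} [Fintype ι] [Fintype κ] {r : ι → ℝ}
    (hr : ∀ i, 0 ≤ r i) {l : κ → ι → ℝ} (hl : ∀ k i, 0 ≤ l k i) :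
    ∑ k, (∑ i, √(l k i) * r i) ^ 2 ≤ (∑ i, √(∑ k, l k i) * r i) ^ 2 := by
  have hsq : ∀ v : ι → ℝ, (∑ i, v i * r i) ^ 2 = ∑ i, ∑ j, (v i * v j) * (r i * r j) := by
    intro v
    rw [sq, Finset.sum_mul_sum]
    refine Finset.sum_congr rfl fun i _ => Finset.sum_congr rfl fun j _ => by ring
  simp_rw [hsq]
  rw [Finset.sum_comm]
  refine Finset.sum_le_sum fun i _ => ?_
  rw [Finset.sum_comm]
  refine Finset.sum_le_sum fun j _ => ?_
  rw [← Finset.sum_mul]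
  refine mul_le_mul_of_nonneg_right ?_ (mul_nonneg (hr i) (hr j))
  exact Real.sum_sqrt_mul_sqrt_le _ (fun k => hl k i) fun k => hl k j

open Matrix

section Contraction

variable {l m n : Type*} [Fintype l] [Fintype m] [DecidableEq n]

/-- `Y` is a contraction: `Yᴴ Y ≤ 1`. -/
def IsContraction (Y : Matrix m n ℂ) : Prop := (1 - Yᴴ * Y).PosSemidef

theorem IsContraction.mul {Y : Matrix l m ℂ} {Z : Matrix m n ℂ} [Fintype n] [DecidableEq m] (hY : IsContraction Y)
    (hZ : IsContraction Z) : IsContraction (Y * Z) := by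
  have h := hZ.add (hY.conjTranspose_mul_mul_same Z)
  have e : 1 - (Y * Z)ᴴ * (Y * Z) = 1 - Zᴴ * Z + Zᴴ * (1 - Yᴴ * Y) * Z := by
    simp only [conjTranspose_mul, Matrix.mul_sub, Matrix.sub_mul, Matrix.mul_assoc, Matrix.mul_one]
    abel
  rw [IsContraction, e]
  exact h

theorem isContraction_of_conjTranspose_mul_eq_one {Y : Matrix m n ℂ} (h : Yᴴ * Y = 1) :
    IsContraction Y := by
  simpa [IsContraction, h] using PosSemidef.zero

theorem IsContraction.sum_col_le {Y : Matrix m n ℂ} (hY : IsContraction Y) (j : n) :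
    ∑ i, ‖Y i j‖ ^ 2 ≤ 1 := by
  have h := hY.diag_nonneg (i := j)
  have e : (1 - Yᴴ * Y : Matrix n n ℂ) j j = ((1 - ∑ i, ‖Y i j‖ ^ 2 : ℝ) : ℂ) := by
    simp [Matrix.mul_apply, Complex.conj_mul']
  rw [e, Complex.zero_le_real] at h
  linarith

theorem IsContraction.sum_row_le {Y : Matrix n m ℂ} (hY : IsContraction Yᴴ) (i : n) :
    ∑ j, ‖Y i j‖ ^ 2 ≤ 1 := by
  simpa using hY.sum_col_le i

end Contraction

/-- The complex diagonal matrix with real entries. -/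
abbrev realDiagonal {n : Type*} [DecidableEq n] (v : n → ℝ) : Matrix n n ℂ :=
  diagonal fun i => (v i : ℂ)

theorem realDiagonal_mul {n : Type*} [Fintype n] [DecidableEq n] (v w : n → ℝ) :
    realDiagonal v * realDiagonal w = realDiagonal fun i => v i * w i := by
  simp [diagonal_mul_diagonal]

theorem conjTranspose_realDiagonal {n : Type*} [DecidableEq n] (v : n → ℝ) :
    (realDiagonal v)ᴴ = realDiagonal v := by
  simp [diagonal_conjTranspose, Pi.star_def]

theorem realDiagonal_posSemidef {n : Type*} [Fintype n] [DecidableEq n] {v : n → ℝ}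
    (hv : ∀ i, 0 ≤ v i) : (realDiagonal v).PosSemidef :=
  PosSemidef.diagonal fun i => by simpa using hv i

/-- `ρ = V diag(v) Vᴴ` with `V` unitary and `v` decreasing and nonnegative. -/
structure IsSortedDiag {d : ℕ} (ρ V : Matrix (Fin d) (Fin d) ℂ) (v : Fin d → ℝ) : Prop where
  left_inv : Vᴴ * V = 1
  right_inv : V * Vᴴ = 1
  antitone : Antitone v
  nonneg : ∀ i, 0 ≤ v i
  eq : ρ = V * realDiagonal v * Vᴴ

theorem exists_isSortedDiag {d : ℕ} {ρ : Matrix (Fin d) (Fin d) ℂ} (h : ρ.PosSemidef) :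
    ∃ V v, IsSortedDiag ρ V v ∧
      ∀ k : ℕ, ∑ i with i.val < k, h.1.eigenvalues₀ i = ∑ i with i.val < k, v i := by
  set E : Fin (Fintype.card (Fin d)) ≃ Fin d := Fintype.equivOfCardEq (Fintype.card_fin _)
  set c : Fin d ≃ Fin (Fintype.card (Fin d)) := finCongr (Fintype.card_fin d).symm
  set e : Fin d ≃ Fin d := c.trans E
  set W : Matrix (Fin d) (Fin d) ℂ := (h.1.eigenvectorUnitary).1
  have hW1 : Wᴴ * W = 1 := Unitary.coe_star_mul_self h.1.eigenvectorUnitary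
  have hW2 : W * Wᴴ = 1 := Unitary.coe_mul_star_self h.1.eigenvectorUnitary
  have hev : ∀ i, h.1.eigenvalues (e i) = h.1.eigenvalues₀ (c i) := by
    intro i
    simp [e, E, Matrix.IsHermitian.eigenvalues]
  refine ⟨W.submatrix id e, fun i => h.1.eigenvalues₀ (c i), ⟨?_, ?_, ?_, ?_, ?_⟩, ?_⟩
  · refine mul_eq_one_comm.1 ?_
    rw [conjTranspose_submatrix, submatrix_mul_equiv, hW2, submatrix_id_id]
  · rw [conjTranspose_submatrix, submatrix_mul_equiv, hW2, submatrix_id_id]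
  · exact fun i j hij => h.1.eigenvalues₀_antitone (by simpa [c] using hij)
  · exact fun i => hev i ▸ h.eigenvalues_nonneg _
  · have hs := h.1.spectral_theorem
    rw [Unitary.conjStarAlgAut_apply] at hs
    have hd : realDiagonal (fun i => h.1.eigenvalues₀ (c i)) =
        (diagonal (RCLike.ofReal ∘ h.1.eigenvalues) : Matrix (Fin d) (Fin d) ℂ).submatrix e e := by
      rw [submatrix_diagonal_equiv]
      congr 1
      ext i
      simp [← hev]
    rw [hd, conjTranspose_submatrix, submatrix_mul_equiv, submatrix_mul_equiv, submatrix_id_id]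
    exact hs
  · intro k
    rw [Finset.sum_filter, Finset.sum_filter, ← Equiv.sum_comp c]
    simp [c]

theorem IsSortedDiag.posSemidef {d : ℕ} {ρ V : Matrix (Fin d) (Fin d) ℂ} {v : Fin d → ℝ}
    (h : IsSortedDiag ρ V v) : ρ.PosSemidef := by
  rw [h.eq]
  exact (realDiagonal_posSemidef h.nonneg).mul_mul_conjTranspose_same V

theorem IsSortedDiag.trace_eq {d : ℕ} {ρ V : Matrix (Fin d) (Fin d) ℂ} {v : Fin d → ℝ}
    (h : IsSortedDiag ρ V v) : ρ.trace = ((∑ i, v i : ℝ) : ℂ) := by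
  rw [h.eq, Matrix.trace_mul_comm, ← Matrix.mul_assoc, h.left_inv, Matrix.one_mul]
  simp [trace_diagonal]

theorem IsSortedDiag.sqrt_eq {d : ℕ} {ρ V : Matrix (Fin d) (Fin d) ℂ} {v : Fin d → ℝ}
    (h : IsSortedDiag ρ V v) : CFC.sqrt ρ = V * realDiagonal (fun i => √(v i)) * Vᴴ := by
  refine CFC.sqrt_unique ?_ ?_
  · rw [h.eq]
    have : realDiagonal v = realDiagonal (fun i => √(v i)) * realDiagonal (fun i => √(v i)) := by
      rw [realDiagonal_mul]
      congr 1; ext i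
      simp [Real.mul_self_sqrt (h.nonneg i)]
    rw [this]
    simp only [Matrix.mul_assoc]
    rw [← Matrix.mul_assoc Vᴴ V, h.left_inv, Matrix.one_mul]
  · rw [Matrix.nonneg_iff_posSemidef]
    exact (realDiagonal_posSemidef fun i => Real.sqrt_nonneg _).mul_mul_conjTranspose_same V

/-- Singular value decomposition. -/
theorem IsSortedDiag.exists_svd {a b : ℕ} {M : Matrix (Fin a) (Fin b) ℂ}
    {V : Matrix (Fin a) (Fin a) ℂ} {v : Fin a → ℝ} (h : IsSortedDiag (M * Mᴴ) V v) :
    ∃ X : Matrix (Fin a) (Fin b) ℂ, M = V * realDiagonal (fun i => √(v i)) * X ∧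
      X * Xᴴ = realDiagonal (fun i => if v i = 0 then 0 else 1) := by
  set R := Vᴴ * M with hR
  have hRR : R * Rᴴ = realDiagonal v := by
    have : R * Rᴴ = Vᴴ * (M * Mᴴ) * V := by
      simp [hR, Matrix.mul_assoc]
    rw [this, h.eq]
    simp only [Matrix.mul_assoc, h.left_inv, Matrix.mul_one]
    rw [← Matrix.mul_assoc, h.left_inv, Matrix.one_mul]
  have hrow : ∀ i j, v i = 0 → R i j = 0 := by
    intro i j hi
    have h1 : (R * Rᴴ) i i = 0 := by rw [hRR]; simp [hi]
    have h2 : ((∑ j, ‖R i j‖ ^ 2 : ℝ) : ℂ) = 0 := by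
      rw [← h1]; simp [Matrix.mul_apply, Complex.mul_conj']
    rw [Complex.ofReal_eq_zero, Finset.sum_eq_zero_iff_of_nonneg (fun _ _ => by positivity)] at h2
    simpa using h2 j (Finset.mem_univ _)
  have hsq : ∀ i, √(v i) = 0 ↔ v i = 0 := fun i => Real.sqrt_eq_zero (h.nonneg i)
  refine ⟨realDiagonal (fun i => (√(v i))⁻¹) * R, ?_, ?_⟩
  · have : realDiagonal (fun i => √(v i)) * (realDiagonal (fun i => (√(v i))⁻¹) * R) = R := by
      ext i j
      rw [diagonal_mul, diagonal_mul]
      by_cases hi : v i = 0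
      · simp [hrow i j hi]
      · have : ((√(v i) : ℝ) : ℂ) ≠ 0 := by exact_mod_cast (hsq i).not.2 hi
        push_cast
        field_simp
    rw [Matrix.mul_assoc, this, hR, ← Matrix.mul_assoc, h.right_inv, Matrix.one_mul]
  · rw [conjTranspose_mul, conjTranspose_realDiagonal, Matrix.mul_assoc, ← Matrix.mul_assoc R, hRR,
      realDiagonal_mul, realDiagonal_mul]
    congr 1; ext i
    split_ifs with hi
    · simp [hi]
    · have h1 := (hsq i).not.2 hi
      have : (√(v i))⁻¹ * (v i * (√(v i))⁻¹) = 1 := by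
        nth_rewrite 2 [← Real.mul_self_sqrt (h.nonneg i)]
        field_simp
      rw [this]

theorem isContraction_conjTranspose_of_mul_eq {a b : ℕ} {X : Matrix (Fin a) (Fin b) ℂ}
    {v : Fin a → ℝ} (hX : X * Xᴴ = realDiagonal (fun i => if v i = 0 then 0 else 1)) :
    IsContraction Xᴴ := by
  rw [IsContraction, conjTranspose_conjTranspose, hX, ← diagonal_one, diagonal_sub]
  refine PosSemidef.diagonal fun i => ?_
  by_cases hi : v i = 0 <;> simp [hi]

theorem isContraction_of_mul_eq {a b : ℕ} {X : Matrix (Fin a) (Fin b) ℂ}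
    {v : Fin a → ℝ} (hX : X * Xᴴ = realDiagonal (fun i => if v i = 0 then 0 else 1)) :
    IsContraction X := by
  have hproj : X * Xᴴ * X = X := by
    rw [hX]
    ext i j
    rw [diagonal_mul]
    dsimp only
    split_ifs with hi
    · have h1 : (X * Xᴴ) i i = 0 := by rw [hX]; simp [hi]
      have h2 : ((∑ j, ‖X i j‖ ^ 2 : ℝ) : ℂ) = 0 := by
        rw [← h1]; simp [Matrix.mul_apply, Complex.mul_conj']
      rw [Complex.ofReal_eq_zero, Finset.sum_eq_zero_iff_of_nonneg (fun _ _ => by positivity)] at h2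
      have := h2 j (Finset.mem_univ _)
      simp at this
      simp [this]
    · simp
  have e : 1 - Xᴴ * X = (1 - Xᴴ * X)ᴴ * (1 - Xᴴ * X) := by
    have : Xᴴ * X * (Xᴴ * X) = Xᴴ * X := by
      rw [Matrix.mul_assoc, ← Matrix.mul_assoc X, hproj]
    simp [Matrix.mul_sub, Matrix.sub_mul, this]
  rw [IsContraction, e]
  exact posSemidef_conjTranspose_mul_self _

/-- Von Neumann's trace inequality. -/
theorem norm_trace_conjTranspose_mul_le {a b : ℕ} {M N : Matrix (Fin a) (Fin b) ℂ}
    {V W : Matrix (Fin a) (Fin a) ℂ} {v w : Fin a → ℝ} (hM : IsSortedDiag (M * Mᴴ) V v)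
    (hN : IsSortedDiag (N * Nᴴ) W w) :
    ‖(Nᴴ * M).trace‖ ≤ ∑ i, √(v i) * √(w i) := by
  obtain ⟨X, hMX, hX⟩ := hM.exists_svd
  obtain ⟨Y, hNY, hY⟩ := hN.exists_svd
  set A := Wᴴ * V with hA
  set Z := X * Yᴴ with hZ
  have hAc : IsContraction A := (isContraction_of_conjTranspose_mul_eq_one (by
    simp [hN.right_inv])).mul (isContraction_of_conjTranspose_mul_eq_one hM.left_inv)
  have hAc' : IsContraction Aᴴ := by
    rw [hA, conjTranspose_mul, conjTranspose_conjTranspose]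
    exact (isContraction_of_conjTranspose_mul_eq_one (by
      simp [hM.right_inv])).mul (isContraction_of_conjTranspose_mul_eq_one hN.left_inv)
  have hZc : IsContraction Z :=
    (isContraction_of_mul_eq hX).mul (isContraction_conjTranspose_of_mul_eq hY)
  have hZc' : IsContraction Zᴴ := by
    rw [hZ, conjTranspose_mul, conjTranspose_conjTranspose]
    exact (isContraction_of_mul_eq hY).mul (isContraction_conjTranspose_of_mul_eq hX)
  have htr : (Nᴴ * M).trace = ∑ i, ∑ j, (√(w i) : ℂ) * A i j * √(v j) * Z j i := by
    have : (Nᴴ * M).trace = (realDiagonal (fun i => √(w i)) * A *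
        realDiagonal (fun i => √(v i)) * Z).trace := by
      conv_lhs => rw [hMX, hNY]
      rw [hZ, ← Matrix.mul_assoc _ X, Matrix.trace_mul_comm _ Yᴴ]
      simp only [hA, conjTranspose_mul, conjTranspose_realDiagonal, Matrix.mul_assoc]
    rw [this, Matrix.trace]
    refine Finset.sum_congr rfl fun i _ => ?_
    rw [Matrix.diag_apply, Matrix.mul_apply]
    refine Finset.sum_congr rfl fun j _ => ?_
    rw [mul_diagonal, diagonal_mul]
  rw [htr]
  set B : Fin a → Fin a → ℝ := fun i j => (‖A i j‖ ^ 2 + ‖Z j i‖ ^ 2) / 2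
  calc _ ≤ ∑ i, ∑ j, ‖(√(w i) : ℂ) * A i j * √(v j) * Z j i‖ :=
        (norm_sum_le _ _).trans (Finset.sum_le_sum fun i _ => norm_sum_le _ _)
    _ ≤ ∑ i, ∑ j, √(w i) * B i j * √(v j) := by
        refine Finset.sum_le_sum fun i _ => Finset.sum_le_sum fun j _ => ?_
        have h1 : ‖A i j‖ * ‖Z j i‖ ≤ B i j := by
          simp only [B]; nlinarith [sq_nonneg (‖A i j‖ - ‖Z j i‖)]
        have h2 : 0 ≤ √(w i) * √(v j) := by positivity
        simp only [norm_mul, Complex.norm_real, Real.norm_eq_abs, abs_of_nonneg (Real.sqrt_nonneg _)]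
        calc _ = √(w i) * √(v j) * (‖A i j‖ * ‖Z j i‖) := by ring
          _ ≤ √(w i) * √(v j) * B i j := mul_le_mul_of_nonneg_left h1 h2
          _ = _ := by ring
    _ ≤ ∑ i, √(w i) * √(v i) := by
        refine sum_mul_substochastic_le (fun i j hij => Real.sqrt_le_sqrt (hN.antitone hij))
          (fun _ => Real.sqrt_nonneg _) (fun i j hij => Real.sqrt_le_sqrt (hM.antitone hij))
          (fun _ => Real.sqrt_nonneg _) (fun i j => by positivity) (fun i => ?_) fun j => ?_
        · rw [← Finset.sum_div, Finset.sum_add_distrib]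
          linarith [hAc'.sum_row_le i, hZc.sum_col_le i]
        · rw [← Finset.sum_div, Finset.sum_add_distrib]
          linarith [hAc.sum_col_le j, hZc'.sum_row_le j]
    _ = _ := by simp_rw [mul_comm]

/-- Ky Fan: reordering and diagonalizing does not decrease partial sums. -/
theorem IsSortedDiag.partialSum_le {d : ℕ} {ρ V W : Matrix (Fin d) (Fin d) ℂ} {v w : Fin d → ℝ}
    (hV : IsSortedDiag ρ V v) (hW : IsSortedDiag ρ W w) (k : ℕ) :
    ∑ i with i.val < k, v i ≤ ∑ i with i.val < k, w i := by
  set A := Wᴴ * V with hA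
  have hAc : IsContraction A := (isContraction_of_conjTranspose_mul_eq_one (by
    simp [hW.right_inv])).mul (isContraction_of_conjTranspose_mul_eq_one hV.left_inv)
  have hAc' : IsContraction Aᴴ := by
    rw [hA, conjTranspose_mul, conjTranspose_conjTranspose]
    exact (isContraction_of_conjTranspose_mul_eq_one (by
      simp [hV.right_inv])).mul (isContraction_of_conjTranspose_mul_eq_one hW.left_inv)
  have hd : realDiagonal v = Aᴴ * realDiagonal w * A := by
    have : Aᴴ * realDiagonal w * A = Vᴴ * ρ * V := by
      rw [hW.eq]; simp [hA, Matrix.mul_assoc]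
    rw [this, hV.eq]
    simp only [Matrix.mul_assoc, hV.left_inv, Matrix.mul_one]
    rw [← Matrix.mul_assoc, hV.left_inv, Matrix.one_mul]
  have hv : ∀ i, v i = ∑ j, ‖A j i‖ ^ 2 * w j := by
    intro i
    have h1 : (realDiagonal v) i i = (v i : ℂ) := by simp
    rw [hd, Matrix.mul_apply] at h1
    have : ((∑ j, ‖A j i‖ ^ 2 * w j : ℝ) : ℂ) = v i := by
      rw [← h1]
      push_cast
      refine Finset.sum_congr rfl fun j _ => ?_
      rw [mul_diagonal, conjTranspose_apply, ← Complex.conj_mul']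
      simp only [RCLike.star_def]
      ring
    exact_mod_cast this.symm
  have := sum_mul_substochastic_le (antitone_indicator_val_lt d k)
    (fun i => by split_ifs <;> norm_num) hW.antitone hW.nonneg
    (B := fun i j => ‖A j i‖ ^ 2) (fun i j => by positivity) (fun i => hAc.sum_col_le i)
    fun j => hAc'.sum_row_le j
  simpa [Finset.sum_filter, hv, ite_and, Finset.sum_ite_irrel] using this

/-- The squared Hilbert–Schmidt norm. -/
def hsSq {m n : Type*} [Fintype m] [Fintype n] (M : Matrix m n ℂ) : ℝ := ∑ i, ∑ j, ‖M i j‖ ^ 2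

theorem trace_mul_conjTranspose_eq_hsSq {m n : Type*} [Fintype m] [Fintype n] (M : Matrix m n ℂ) :
    (M * Mᴴ).trace = (hsSq M : ℂ) := by
  simp [hsSq, Matrix.trace, Matrix.mul_apply, Complex.mul_conj']

theorem IsSortedDiag.sum_eq_hsSq {a b : ℕ} {M : Matrix (Fin a) (Fin b) ℂ}
    {V : Matrix (Fin a) (Fin a) ℂ} {v : Fin a → ℝ} (h : IsSortedDiag (M * Mᴴ) V v) :
    ∑ i, v i = hsSq M := by
  have := h.trace_eq
  rw [trace_mul_conjTranspose_eq_hsSq] at this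
  exact_mod_cast this.symm

theorem hsSq_sub {m n : Type*} [Fintype m] [Fintype n] (M N : Matrix m n ℂ) :
    hsSq (M - N) = hsSq M + hsSq N - 2 * (Nᴴ * M).trace.re := by
  have h : ∀ x y : ℂ, ‖x - y‖ ^ 2 = ‖x‖ ^ 2 + ‖y‖ ^ 2 - 2 * (star y * x).re := by
    intro x y
    simp only [← Complex.normSq_eq_norm_sq, Complex.normSq_apply, Complex.sub_re, Complex.sub_im,
      Complex.mul_re, RCLike.star_def, Complex.conj_re, Complex.conj_im]
    ring
  have ht : (Nᴴ * M).trace.re = ∑ i, ∑ j, (star (N i j) * M i j).re := by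
    simp only [Matrix.trace, Matrix.diag_apply, Matrix.mul_apply, conjTranspose_apply,
      Complex.re_sum]
    rw [Finset.sum_comm]
  simp only [hsSq, Matrix.sub_apply, h, ht, Finset.sum_sub_distrib, Finset.sum_add_distrib,
    ← Finset.mul_sum]

theorem IsSortedDiag.eq_zero_of_rank_le {d m : ℕ} {ρ V : Matrix (Fin d) (Fin d) ℂ}
    {v : Fin d → ℝ} (h : IsSortedDiag ρ V v) (hr : ρ.rank ≤ m) (i : Fin d) (hi : m ≤ i.val) :
    v i = 0 := by
  by_contra hne
  have hVu : IsUnit V.det := (Matrix.isUnit_iff_isUnit_det _).1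
    (IsUnit.of_mul_eq_one _ h.right_inv)
  have hVu' : IsUnit Vᴴ.det := (Matrix.isUnit_iff_isUnit_det _).1
    (IsUnit.of_mul_eq_one _ h.left_inv)
  rw [h.eq, rank_mul_eq_left_of_isUnit_det _ _ hVu', rank_mul_eq_right_of_isUnit_det _ _ hVu,
    rank_diagonal, Fintype.card_subtype] at hr
  have hsub : Finset.Iic i ⊆ Finset.univ.filter fun j => (v j : ℂ) ≠ 0 := by
    intro j hj
    have h1 : v i ≤ v j := h.antitone (Finset.mem_Iic.1 hj)
    have h2 : 0 < v i := lt_of_le_of_ne (h.nonneg i) (Ne.symm hne)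
    simp only [Finset.mem_filter, Finset.mem_univ, true_and, ne_eq, Complex.ofReal_eq_zero]
    linarith
  have := Finset.card_le_card hsub
  rw [Fin.card_Iic] at this
  omega

/-- Eckart–Young–Mirsky, lower bound. -/
theorem IsSortedDiag.tail_le_hsSq_sub {a b m : ℕ} {M N : Matrix (Fin a) (Fin b) ℂ}
    {V : Matrix (Fin a) (Fin a) ℂ} {v : Fin a → ℝ} (h : IsSortedDiag (M * Mᴴ) V v)
    (hN : N.rank ≤ m) :
    ∑ i, v i - ∑ i with i.val < m, v i ≤ hsSq (M - N) := by
  obtain ⟨W, w, hW, -⟩ := exists_isSortedDiag (posSemidef_self_mul_conjTranspose N)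
  have hw : ∀ i : Fin a, m ≤ i.val → w i = 0 :=
    hW.eq_zero_of_rank_le (by rwa [rank_self_mul_conjTranspose])
  have htr : (Nᴴ * M).trace.re ≤ ∑ i, √(v i) * √(w i) :=
    (Complex.re_le_norm _).trans (norm_trace_conjTranspose_mul_le h hW)
  have hle : ∑ i, v i - ∑ i with i.val < m, v i ≤
      ∑ i, v i + ∑ i, w i - 2 * ∑ i, √(v i) * √(w i) := by
    rw [Finset.sum_filter, ← Finset.sum_sub_distrib, ← Finset.sum_add_distrib, Finset.mul_sum,
      ← Finset.sum_sub_distrib]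
    refine Finset.sum_le_sum fun i _ => ?_
    split_ifs with hi
    · nlinarith [sq_nonneg (√(v i) - √(w i)), Real.sq_sqrt (h.nonneg i), Real.sq_sqrt (hW.nonneg i)]
    · simp [hw i (not_lt.1 hi)]
  rw [hsSq_sub, ← h.sum_eq_hsSq, ← hW.sum_eq_hsSq]
  linarith

/-- Eckart–Young–Mirsky, attainment. -/
theorem IsSortedDiag.exists_rank_le_hsSq_sub_eq {a b : ℕ} {M : Matrix (Fin a) (Fin b) ℂ}
    {V : Matrix (Fin a) (Fin a) ℂ} {v : Fin a → ℝ} (h : IsSortedDiag (M * Mᴴ) V v) (m : ℕ) :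
    ∃ N : Matrix (Fin a) (Fin b) ℂ, N.rank ≤ m ∧
      hsSq (M - N) = ∑ i, v i - ∑ i with i.val < m, v i := by
  set e : Fin a → ℝ := fun i => if i.val < m then 1 else 0
  set f : Fin a → ℝ := fun i => if i.val < m then 0 else 1
  refine ⟨V * realDiagonal e * Vᴴ * M, ?_, ?_⟩
  · refine (rank_mul_le_left _ _).trans ((rank_mul_le_left _ _).trans
      ((rank_mul_le_right _ _).trans ?_))
    rw [rank_diagonal, Fintype.card_subtype]
    refine (Finset.card_le_card fun i hi => ?_).trans (card_filter_val_lt_le a m)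
    simpa [e] using hi
  · have h1 : M - V * realDiagonal e * Vᴴ * M = V * realDiagonal f * Vᴴ * M := by
      have : realDiagonal f = 1 - realDiagonal e := by
        rw [← diagonal_one, diagonal_sub]
        refine congrArg diagonal (funext fun i => ?_)
        by_cases hi : i.val < m <;> simp [e, f, hi]
      rw [this]
      simp [Matrix.mul_sub, Matrix.sub_mul, h.right_inv]
    have h2 : ((hsSq (V * realDiagonal f * Vᴴ * M) : ℝ) : ℂ) =
        ((∑ i, f i * v i * f i : ℝ) : ℂ) := by
      rw [← trace_mul_conjTranspose_eq_hsSq]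
      have : V * realDiagonal f * Vᴴ * M * (V * realDiagonal f * Vᴴ * M)ᴴ =
          V * realDiagonal (fun i => f i * v i * f i) * Vᴴ := by
        rw [← realDiagonal_mul, ← realDiagonal_mul]
        have e1 : V * realDiagonal f * Vᴴ * M * (V * realDiagonal f * Vᴴ * M)ᴴ =
          V * realDiagonal f * Vᴴ * (M * Mᴴ) * V * realDiagonal f * Vᴴ := by
          simp only [conjTranspose_mul, conjTranspose_realDiagonal, conjTranspose_conjTranspose,
            Matrix.mul_assoc]
        rw [e1, h.eq]
        have e2 : ∀ Z : Matrix (Fin a) (Fin a) ℂ, Vᴴ * (V * Z) = Z := fun Z => by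
          rw [← Matrix.mul_assoc, h.left_inv, Matrix.one_mul]
        simp only [Matrix.mul_assoc, e2]
      rw [this, Matrix.trace_mul_comm, ← Matrix.mul_assoc, h.left_inv, Matrix.one_mul]
      simp [trace_diagonal]
    rw [h1, Complex.ofReal_injective h2, Finset.sum_filter, ← Finset.sum_sub_distrib]
    refine Finset.sum_congr rfl fun i _ => ?_
    by_cases hi : i.val < m <;> simp [f, hi]

/-- The coefficient matrix of a bipartite vector. -/
def coeffMatrix {a b : ℕ} (Φ : BipVec a b) : Matrix (Fin a) (Fin b) ℂ :=
  Matrix.of fun i j => Φ (i, j)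

theorem reducedDensity_eq {a b : ℕ} (Φ : BipVec a b) :
    reducedDensity Φ = coeffMatrix Φ * (coeffMatrix Φ)ᴴ := by
  ext i i'
  simp [reducedDensity, partialTraceB, pureState, vecMulVec_apply, coeffMatrix, Matrix.mul_apply]

theorem hsSq_coeffMatrix {a b : ℕ} (Φ : BipVec a b) : hsSq (coeffMatrix Φ) = ‖Φ‖ ^ 2 := by
  rw [EuclideanSpace.norm_sq_eq, Fintype.sum_prod_type]
  rfl

theorem fidelity_sum {a b : ℕ} {ι : Type*} (s : Finset ι) (Ψ : BipVec a b) (X : ι → BipOp a b) :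
    fidelity Ψ (∑ k ∈ s, X k) = ∑ k ∈ s, fidelity Ψ (X k) := by
  simp only [fidelity, Matrix.sum_mulVec, dotProduct_sum, Complex.re_sum]

theorem fidelity_conj_pureState {a b a' b' : ℕ} (Φ : BipVec a b) (Ψ : BipVec a' b')
    (S : Matrix (Fin a' × Fin b') (Fin a × Fin b) ℂ) :
    fidelity Ψ (S * pureState Φ * Sᴴ) =
      ‖(fun x => star (Ψ x)) ⬝ᵥ (S *ᵥ (fun x => Φ x))‖ ^ 2 := by
  set z := (fun x => star (Ψ x)) ⬝ᵥ (S *ᵥ (fun x => Φ x)) with hz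
  have h1 : S * pureState Φ * Sᴴ =
      vecMulVec (S *ᵥ (fun x => Φ x)) (star (S *ᵥ (fun x => Φ x))) := by
    rw [pureState, Matrix.mul_vecMulVec, Matrix.vecMulVec_mul, star_mulVec]
    rfl
  have h2 : star (S *ᵥ (fun x => Φ x)) ⬝ᵥ (fun x => Ψ x) = star z := by
    rw [hz, star_dotProduct]
    rfl
  rw [fidelity, h1, vecMulVec_mulVec, h2]
  rw [dotProduct_smul, ← hz, op_smul_eq_mul, RCLike.star_def, Complex.mul_conj']
  exact_mod_cast rfl

theorem dotProduct_kronecker_mulVec {a b a' b' : ℕ} (Φ : BipVec a b) (Ψ : BipVec a' b')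
    (A : Matrix (Fin a') (Fin a) ℂ) (B : Matrix (Fin b') (Fin b) ℂ) :
    (fun x => star (Ψ x)) ⬝ᵥ ((A ⊗ₖ B) *ᵥ (fun x => Φ x)) =
      ((coeffMatrix Ψ)ᴴ * (A * coeffMatrix Φ * Bᵀ)).trace := by
  simp only [dotProduct, mulVec, Fintype.sum_prod_type, kronecker_apply, Matrix.trace, diag_apply,
    Matrix.mul_apply, conjTranspose_apply, coeffMatrix, of_apply, transpose_apply]
  rw [Finset.sum_comm]
  refine Finset.sum_congr rfl fun j _ => Finset.sum_congr rfl fun i _ => ?_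
  congr 1
  rw [Finset.sum_comm]
  refine Finset.sum_congr rfl fun l _ => ?_
  rw [Finset.sum_mul]
  exact Finset.sum_congr rfl fun k _ => by ring

theorem fidelity_kronecker {a b a' b' : ℕ} (Φ : BipVec a b) (Ψ : BipVec a' b')
    (A : Matrix (Fin a') (Fin a) ℂ) (B : Matrix (Fin b') (Fin b) ℂ) :
    fidelity Ψ ((A ⊗ₖ B) * pureState Φ * (A ⊗ₖ B)ᴴ) =
      ‖((coeffMatrix Ψ)ᴴ * (A * coeffMatrix Φ * Bᵀ)).trace‖ ^ 2 := by
  rw [fidelity_conj_pureState, dotProduct_kronecker_mulVec]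

theorem mul_kronecker_eq {a b a' b' e : ℕ} (A : Matrix (Fin a') (Fin e) ℂ)
    (K : Matrix (Fin e) (Fin a) ℂ) (B : Matrix (Fin b') (Fin b) ℂ) :
    (A * K) ⊗ₖ B = (A ⊗ₖ B) * (K ⊗ₖ (1 : Matrix (Fin b) (Fin b) ℂ)) := by
  rw [← mul_kronecker_mul, Matrix.mul_one]

theorem kronecker_mul_eq {a b a' b' e : ℕ} (A : Matrix (Fin a') (Fin a) ℂ)
    (B : Matrix (Fin b') (Fin e) ℂ) (K : Matrix (Fin e) (Fin b) ℂ) :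
    A ⊗ₖ (B * K) = (A ⊗ₖ B) * ((1 : Matrix (Fin a) (Fin a) ℂ) ⊗ₖ K) := by
  rw [← mul_kronecker_mul, Matrix.mul_one]

theorem sum_conjTranspose_mul_mul_right {ι l m n : Type*} [Fintype ι] [Fintype l] [Fintype m]
    [DecidableEq m] {S : ι → Matrix l m ℂ} (hS : ∑ r, (S r)ᴴ * S r = 1) (T : Matrix m n ℂ) :
    ∑ r, (S r * T)ᴴ * (S r * T) = Tᴴ * T := by
  have h : ∀ r, (S r * T)ᴴ * (S r * T) = Tᴴ * ((S r)ᴴ * S r) * T := fun r => by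
    simp only [conjTranspose_mul, Matrix.mul_assoc]
  simp only [h]
  rw [← Matrix.sum_mul, ← Matrix.mul_sum, hS, Matrix.mul_one]

/-- Every LOCC operation is separable: it has a trace-preserving family of product Kraus
operators. -/
theorem IsLOCC.exists_kraus {a' b' a b : ℕ} {C : BipOp a b → BipOp a' b'} (h : IsLOCC C) :
    ∃ (ι : Type) (_ : Fintype ι) (A : ι → Matrix (Fin a') (Fin a) ℂ)
      (B : ι → Matrix (Fin b') (Fin b) ℂ),
      (∀ X, C X = ∑ k, (A k ⊗ₖ B k) * X * (A k ⊗ₖ B k)ᴴ) ∧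
        ∑ k, (A k ⊗ₖ B k)ᴴ * (A k ⊗ₖ B k) = 1 := by
  induction h with
  | refl => exact ⟨Unit, inferInstance, fun _ => 1, fun _ => 1, by simp, by simp⟩
  | @alice a b m l e K hK C hC ih =>
    choose ι hι A B hA hB using ih
    refine ⟨(k : Fin m) × (Fin l × ι k), inferInstance, fun x => A x.1 x.2.2 * K x.1 x.2.1,
      fun x => B x.1 x.2.2, fun X => ?_, ?_⟩
    · simp only [Fintype.sum_sigma, Fintype.sum_prod_type, mul_kronecker_eq]
      refine Finset.sum_congr rfl fun k _ => ?_
      rw [hA, Finset.sum_comm]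
      refine Finset.sum_congr rfl fun r _ => ?_
      rw [aliceMap, Matrix.mul_sum, Matrix.sum_mul]
      simp only [conjTranspose_mul, Matrix.mul_assoc]
    · simp only [Fintype.sum_sigma, Fintype.sum_prod_type, mul_kronecker_eq]
      simp only [sum_conjTranspose_mul_mul_right (hB _)]
      rw [← one_kronecker_one, ← hK]
      simp only [conjTranspose_kronecker, ← mul_kronecker_mul, conjTranspose_one, Matrix.mul_one]
      ext x y
      simp [Matrix.sum_apply, Finset.sum_mul]
  | @bob a b m l e K hK C hC ih =>
    choose ι hι A B hA hB using ih
    refine ⟨(k : Fin m) × (Fin l × ι k), inferInstance, fun x => A x.1 x.2.2,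
      fun x => B x.1 x.2.2 * K x.1 x.2.1, fun X => ?_, ?_⟩
    · simp only [Fintype.sum_sigma, Fintype.sum_prod_type, kronecker_mul_eq]
      refine Finset.sum_congr rfl fun k _ => ?_
      rw [hA, Finset.sum_comm]
      refine Finset.sum_congr rfl fun r _ => ?_
      rw [bobMap, Matrix.mul_sum, Matrix.sum_mul]
      simp only [conjTranspose_mul, Matrix.mul_assoc]
    · simp only [Fintype.sum_sigma, Fintype.sum_prod_type, kronecker_mul_eq]
      simp only [sum_conjTranspose_mul_mul_right (hB _)]
      rw [← one_kronecker_one, ← hK]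
      simp only [conjTranspose_kronecker, ← mul_kronecker_mul, conjTranspose_one, Matrix.mul_one]
      ext x y
      simp [Matrix.sum_apply, Finset.mul_sum]

theorem sum_hsSq_kraus {ι : Type} [Fintype ι] {a b a' b' : ℕ}
    {A : ι → Matrix (Fin a') (Fin a) ℂ} {B : ι → Matrix (Fin b') (Fin b) ℂ}
    (h : ∑ k, (A k ⊗ₖ B k)ᴴ * (A k ⊗ₖ B k) = 1) (Y : Matrix (Fin a) (Fin b) ℂ) :
    ∑ k, hsSq (A k * Y * (B k)ᵀ) = hsSq Y := by
  set y : Fin a × Fin b → ℂ := fun x => Y x.1 x.2 with hy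
  have h0 : ((hsSq Y : ℝ) : ℂ) = star y ⬝ᵥ y := by
    simp [hsSq, dotProduct, Fintype.sum_prod_type, hy, Complex.conj_mul']
  have h1 : ∀ k, ((hsSq (A k * Y * (B k)ᵀ) : ℝ) : ℂ) =
      star y ⬝ᵥ (((A k ⊗ₖ B k)ᴴ * (A k ⊗ₖ B k)) *ᵥ y) := by
    intro k
    have h2 : ∀ i j, (A k * Y * (B k)ᵀ) i j = ((A k ⊗ₖ B k) *ᵥ y) (i, j) := by
      intro i j
      simp only [mulVec, dotProduct, Fintype.sum_prod_type, kronecker_apply, Matrix.mul_apply,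
        transpose_apply, hy, Finset.sum_mul]
      rw [Finset.sum_comm]
      exact Finset.sum_congr rfl fun _ _ => Finset.sum_congr rfl fun _ _ => by ring
    rw [← mulVec_mulVec, dotProduct_mulVec, ← star_mulVec]
    simp [hsSq, dotProduct, Fintype.sum_prod_type, h2, Complex.conj_mul']
  have h3 : ((∑ k, hsSq (A k * Y * (B k)ᵀ) : ℝ) : ℂ) = (hsSq Y : ℝ) := by
    rw [Complex.ofReal_sum, h0]
    simp only [h1]
    rw [← dotProduct_sum, ← Matrix.sum_mulVec, h, one_mulVec]
  exact_mod_cast h3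

/-- The fidelity reached by an LOCC operation is bounded by the overlap of the Schmidt coefficients
of the target with those of some distribution majorizing the initial one. -/
theorem IsLOCC.exists_fidelity_le {a b : ℕ} {C : BipOp a b → BipOp a b} (hC : IsLOCC C)
    (Φ Ψ : BipVec a b) {V W : Matrix (Fin a) (Fin a) ℂ} {v w : Fin a → ℝ}
    (hV : IsSortedDiag (reducedDensity Φ) V v) (hW : IsSortedDiag (reducedDensity Ψ) W w) :
    ∃ p : Fin a → ℝ, Antitone p ∧ (∀ i, 0 ≤ p i) ∧ ∑ i, p i = ∑ i, v i ∧
      (∀ k : ℕ, ∑ i with i.val < k, v i ≤ ∑ i with i.val < k, p i) ∧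
      fidelity Ψ (C (pureState Φ)) ≤ (∑ i, √(p i) * √(w i)) ^ 2 := by
  obtain ⟨ι, _, A, B, hX, hAB⟩ := hC.exists_kraus
  rw [reducedDensity_eq] at hV hW
  set M := coeffMatrix Φ
  have hsd : ∀ k, ∃ U u, IsSortedDiag ((A k * M * (B k)ᵀ) * (A k * M * (B k)ᵀ)ᴴ) U u := fun k =>
    let ⟨U, u, h, _⟩ := exists_isSortedDiag (posSemidef_self_mul_conjTranspose (A k * M * (B k)ᵀ))
    ⟨U, u, h⟩
  choose U u hU using hsd
  have hsum : ∑ i, ∑ k, u k i = ∑ i, v i := by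
    rw [Finset.sum_comm, hV.sum_eq_hsSq, ← sum_hsSq_kraus hAB]
    exact Finset.sum_congr rfl fun k _ => (hU k).sum_eq_hsSq
  refine ⟨fun i => ∑ k, u k i, fun i j hij => Finset.sum_le_sum fun k _ => (hU k).antitone hij,
    fun i => Finset.sum_nonneg fun k _ => (hU k).nonneg i, hsum, fun m => ?_, ?_⟩
  · obtain ⟨N, hNr, hN⟩ := hV.exists_rank_le_hsSq_sub_eq m
    have h1 : ∀ k, ∑ i, u k i - ∑ i with i.val < m, u k i ≤ hsSq (A k * (M - N) * (B k)ᵀ) := by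
      intro k
      rw [Matrix.mul_sub, Matrix.sub_mul]
      exact (hU k).tail_le_hsSq_sub
        ((rank_mul_le_left _ _).trans ((rank_mul_le_right _ _).trans hNr))
    have h2 := Finset.sum_le_sum fun k (_ : k ∈ Finset.univ) => h1 k
    rw [sum_hsSq_kraus hAB, hN, Finset.sum_sub_distrib, Finset.sum_comm, hsum] at h2
    rw [Finset.sum_comm]
    linarith
  · rw [hX, fidelity_sum]
    refine le_trans ?_ (sum_sq_sum_sqrt_mul_le (fun i => Real.sqrt_nonneg _)
      fun k i => (hU k).nonneg i)
    refine Finset.sum_le_sum fun k _ => ?_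
    rw [fidelity_kronecker]
    exact pow_le_pow_left₀ (norm_nonneg _) (norm_trace_conjTranspose_mul_le (hU k) hW) 2

/-- A measurement by Alice, after which Bob applies a contraction depending on the outcome, can be
completed to an LOCC operation. -/
theorem exists_isLOCC_of_contraction {a b m : ℕ} (K : Fin m → Matrix (Fin a) (Fin a) ℂ)
    (hK : ∑ j, (K j)ᴴ * K j = 1) (Y : Fin m → Matrix (Fin b) (Fin b) ℂ)
    (hY : ∀ j, IsContraction (Y j)ᴴ) :
    ∃ C : BipOp a b → BipOp a b, IsLOCC C ∧ ∀ Φ Ψ : BipVec a b,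
      ∑ j, ‖((coeffMatrix Ψ)ᴴ * (K j * coeffMatrix Φ * Y j)).trace‖ ^ 2 ≤
        fidelity Ψ (C (pureState Φ)) := by
  have hR : ∀ j, ∃ R : Matrix (Fin b) (Fin b) ℂ, 1 - ((Y j)ᵀ)ᴴ * (Y j)ᵀ = Rᴴ * R := by
    intro j
    have h1 := (hY j).transpose
    have h2 : (1 - (Y j)ᴴᴴ * (Y j)ᴴ)ᵀ = 1 - ((Y j)ᵀ)ᴴ * (Y j)ᵀ := by
      rw [transpose_sub, transpose_one, transpose_mul, conjTranspose_conjTranspose]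
      rfl
    rw [h2] at h1
    exact CStarAlgebra.nonneg_iff_eq_star_mul_self.1 h1.nonneg
  choose R hR using hR
  refine ⟨_, IsLOCC.alice (l := 1) (fun _ => a) (fun j _ => K j) (by simpa using hK) _
    fun j => IsLOCC.bob (m := 1) (l := 2) (fun _ => b) (fun _ => ![(Y j)ᵀ, R j]) ?_ _
      fun _ => IsLOCC.refl, fun Φ Ψ => ?_⟩
  · simp [Fin.sum_univ_two, ← hR j]
  · rw [fidelity_sum]
    refine Finset.sum_le_sum fun j _ => ?_
    have hk : ∀ L : Matrix (Fin b) (Fin b) ℂ,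
        ((1 : Matrix (Fin a) (Fin a) ℂ) ⊗ₖ L) * ((K j ⊗ₖ (1 : Matrix (Fin b) (Fin b) ℂ)) *
          pureState Φ * (K j ⊗ₖ (1 : Matrix (Fin b) (Fin b) ℂ))ᴴ) *
          ((1 : Matrix (Fin a) (Fin a) ℂ) ⊗ₖ L)ᴴ =
        (K j ⊗ₖ L) * pureState Φ * (K j ⊗ₖ L)ᴴ := by
      intro L
      have : K j ⊗ₖ L = ((1 : Matrix (Fin a) (Fin a) ℂ) ⊗ₖ L) *
          (K j ⊗ₖ (1 : Matrix (Fin b) (Fin b) ℂ)) := by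
        rw [← mul_kronecker_mul, Matrix.mul_one, Matrix.one_mul]
      rw [this, conjTranspose_mul]
      simp only [Matrix.mul_assoc]
    simp only [Finset.univ_unique, Finset.sum_singleton, bobMap, aliceMap, hk]
    rw [fidelity_sum, Fin.sum_univ_two, fidelity_kronecker, fidelity_kronecker]
    exact le_add_of_nonneg_right (by positivity)

theorem perm_mul_realDiagonal_mul {n : ℕ} (π : Equiv.Perm (Fin n)) (p : Fin n → ℝ) :
    (1 : Matrix (Fin n) (Fin n) ℂ).submatrix id π * realDiagonal (fun i => p (π i)) *
      ((1 : Matrix (Fin n) (Fin n) ℂ).submatrix id π)ᴴ = realDiagonal p := by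
  have : realDiagonal (fun i => p (π i)) = (realDiagonal p).submatrix π π := by
    rw [submatrix_diagonal_equiv]
    rfl
  rw [this, conjTranspose_submatrix, submatrix_mul_equiv, submatrix_mul_equiv]
  simp

/-- The overlap of the Schmidt coefficients of the target with any distribution majorizing the
initial one is reached by an LOCC operation. -/
theorem exists_isLOCC_le_fidelity {a b : ℕ} (Φ Ψ : BipVec a b) {V W : Matrix (Fin a) (Fin a) ℂ}
    {v w p : Fin a → ℝ} (hV : IsSortedDiag (reducedDensity Φ) V v)
    (hW : IsSortedDiag (reducedDensity Ψ) W w) (hp : ∀ i, 0 ≤ p i)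
    (hsum : ∑ i, p i = ∑ i, v i)
    (hvp : ∀ k : ℕ, ∑ i with i.val < k, v i ≤ ∑ i with i.val < k, p i) :
    ∃ C : BipOp a b → BipOp a b, IsLOCC C ∧
      (∑ i, √(p i) * √(w i)) ^ 2 ≤ fidelity Ψ (C (pureState Φ)) := by
  obtain ⟨m, t, π, ht, ht1, hv⟩ := exists_convex_combination_perm hV.antitone hvp hsum.symm
  rw [reducedDensity_eq] at hV hW
  obtain ⟨X, hM, hX⟩ := hV.exists_svd
  obtain ⟨X', hN, hX'⟩ := hW.exists_svd
  set Q : Fin m → Matrix (Fin a) (Fin a) ℂ := fun j =>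
    (1 : Matrix (Fin a) (Fin a) ℂ).submatrix id (π j) with hQ
  have hQ1 : ∀ j, Q j * (Q j)ᴴ = 1 := fun j => by
    simp only [hQ]
    rw [conjTranspose_submatrix, submatrix_mul_equiv]
    simp
  have hQ2 : ∀ j, (Q j)ᴴ * Q j = 1 := fun j => mul_eq_one_comm.1 (hQ1 j)
  set c : Fin m → Fin a → ℝ := fun j i =>
    √(t j) * if v i = 0 then 1 else √(p (π j i) / v i) with hc
  have hcv : ∀ j i, c j i * (√(v i) * if v i = 0 then 0 else 1) = √(t j) * √(p (π j i)) := by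
    intro j i
    by_cases hi : v i = 0
    · have h1 : ∑ j, t j * p (π j i) = 0 := by rw [← hv, hi]
      rw [Finset.sum_eq_zero_iff_of_nonneg fun j _ => mul_nonneg (ht j) (hp _)] at h1
      rw [← Real.sqrt_mul (ht j), h1 j (Finset.mem_univ _)]
      simp [hi]
    · have hpos : 0 < v i := lt_of_le_of_ne (hV.nonneg i) (Ne.symm hi)
      simp only [hc, hi, if_false, mul_one]
      rw [mul_assoc, ← Real.sqrt_mul (div_nonneg (hp _) hpos.le), div_mul_cancel₀ _ hi]
  have hcc : ∀ i, ∑ j, c j i * c j i = 1 := by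
    intro i
    by_cases hi : v i = 0
    · simp only [hc, hi, if_true, mul_one]
      simp_rw [Real.mul_self_sqrt (ht _)]
      exact ht1
    · have hpos : 0 < v i := lt_of_le_of_ne (hV.nonneg i) (Ne.symm hi)
      have : ∀ j, c j i * c j i = t j * p (π j i) / v i := by
        intro j
        simp only [hc, hi, if_false]
        rw [mul_mul_mul_comm, Real.mul_self_sqrt (ht j),
          Real.mul_self_sqrt (div_nonneg (hp _) hpos.le), mul_div_assoc]
      simp_rw [this]
      rw [← Finset.sum_div, ← hv, div_self hi]
  obtain ⟨C, hC, hCf⟩ := exists_isLOCC_of_contraction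
    (fun j => W * Q j * realDiagonal (c j) * Vᴴ) (by
      have h1 : ∀ j, (W * Q j * realDiagonal (c j) * Vᴴ)ᴴ * (W * Q j * realDiagonal (c j) * Vᴴ) =
          V * realDiagonal (fun i => c j i * c j i) * Vᴴ := by
        intro j
        have h2 : (W * Q j * realDiagonal (c j) * Vᴴ)ᴴ * (W * Q j * realDiagonal (c j) * Vᴴ) =
            V * realDiagonal (c j) * ((Q j)ᴴ * (Wᴴ * W) * Q j) * realDiagonal (c j) * Vᴴ := by
          simp only [conjTranspose_mul, conjTranspose_realDiagonal, conjTranspose_conjTranspose,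
            Matrix.mul_assoc]
        rw [h2, hW.left_inv, Matrix.mul_one, hQ2, Matrix.mul_one, Matrix.mul_assoc V,
          realDiagonal_mul]
      simp only [h1]
      rw [← Finset.sum_mul, ← Finset.mul_sum]
      have h3 : ∑ j, realDiagonal (fun i => c j i * c j i) = 1 := by
        ext i i'
        rw [Matrix.sum_apply]
        by_cases hii : i = i'
        · subst hii
          simp only [diagonal_apply_eq, one_apply_eq]
          exact_mod_cast hcc i
        · simp [hii]
      rw [h3, Matrix.mul_one, hV.right_inv])
    (fun j => Xᴴ * (Q j)ᴴ * X') (fun j => by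
      simp only [conjTranspose_mul, conjTranspose_conjTranspose, ← Matrix.mul_assoc]
      exact ((isContraction_conjTranspose_of_mul_eq hX').mul
        (isContraction_of_conjTranspose_mul_eq_one (hQ2 j))).mul (isContraction_of_mul_eq hX))
  refine ⟨C, hC, le_trans (le_of_eq ?_) (hCf Φ Ψ)⟩
  have hprod : ∀ j, W * Q j * realDiagonal (c j) * Vᴴ * coeffMatrix Φ * (Xᴴ * (Q j)ᴴ * X') =
      W * realDiagonal (fun i => √(t j) * √(p i)) * X' := by
    intro j
    conv_lhs => rw [hM]
    have h1 : W * Q j * realDiagonal (c j) * Vᴴ * (V * realDiagonal (fun i => √(v i)) * X) *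
        (Xᴴ * (Q j)ᴴ * X') = W * (Q j * (realDiagonal (c j) * (Vᴴ * V) *
          (realDiagonal (fun i => √(v i)) * (X * Xᴴ))) * (Q j)ᴴ) * X' := by
      simp only [Matrix.mul_assoc]
    rw [h1, hV.left_inv, Matrix.mul_one, hX, realDiagonal_mul, realDiagonal_mul]
    simp only [hcv]
    rw [hQ, perm_mul_realDiagonal_mul (π j) fun i => √(t j) * √(p i)]
  have htr : ∀ j, ((coeffMatrix Ψ)ᴴ * (W * realDiagonal (fun i => √(t j) * √(p i)) * X')).trace =
      ((√(t j) * ∑ i, √(p i) * √(w i) : ℝ) : ℂ) := by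
    intro j
    conv_lhs => rw [hN]
    have h1 : (W * realDiagonal (fun i => √(w i)) * X')ᴴ *
        (W * realDiagonal (fun i => √(t j) * √(p i)) * X') =
        X'ᴴ * (realDiagonal (fun i => √(w i)) * (Wᴴ * W) *
          realDiagonal (fun i => √(t j) * √(p i)) * X') := by
      simp only [conjTranspose_mul, conjTranspose_realDiagonal, Matrix.mul_assoc]
    rw [h1, hW.left_inv, Matrix.mul_one, Matrix.trace_mul_comm, Matrix.mul_assoc, hX',
      realDiagonal_mul, realDiagonal_mul, trace_diagonal, Finset.mul_sum, Complex.ofReal_sum]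
    refine Finset.sum_congr rfl fun i _ => ?_
    congr 1
    by_cases hi : w i = 0
    · simp [hi]
    · simp only [hi, if_false]; ring
  simp only [hprod, htr]
  simp only [Complex.norm_real, Real.norm_eq_abs, sq_abs, mul_pow, Real.sq_sqrt (ht _)]
  rw [← Finset.sum_mul, ht1, one_mul]

theorem reducedDensity_posSemidef {a b : ℕ} (Φ : BipVec a b) : (reducedDensity Φ).PosSemidef := by
  rw [reducedDensity_eq]
  exact posSemidef_self_mul_conjTranspose _

/-- The decreasing probability vectors whose partial sums dominate those of `v`. -/
def majorizingVectors {d : ℕ} (v : Fin d → ℝ) : Set (Fin d → ℝ) :=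
  {p | Antitone p ∧ (∀ i, 0 ≤ p i) ∧ ∑ i, p i = 1 ∧
    ∀ k : ℕ, ∑ i with i.val < k, v i ≤ ∑ i with i.val < k, p i}

theorem isCompact_majorizingVectors {d : ℕ} (v : Fin d → ℝ) :
    IsCompact (majorizingVectors v) := by
  refine (isCompact_Icc (a := (0 : Fin d → ℝ)) (b := 1)).of_isClosed_subset ?_ ?_
  · have : majorizingVectors v = (⋂ (i) (j) (_ : i ≤ j), {p | p j ≤ p i}) ∩
        ((⋂ i, {p | 0 ≤ p i}) ∩ ({p | ∑ i, p i = 1} ∩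
          ⋂ k : ℕ, {p | ∑ i with i.val < k, v i ≤ ∑ i with i.val < k, p i})) := by
      ext p
      simp [majorizingVectors, Antitone]
    rw [this]
    refine IsClosed.inter ?_ (IsClosed.inter ?_ (IsClosed.inter ?_ ?_))
    · exact isClosed_iInter fun i => isClosed_iInter fun j => isClosed_iInter fun _ =>
        isClosed_le (continuous_apply _) (continuous_apply _)
    · exact isClosed_iInter fun i => isClosed_le continuous_const (continuous_apply _)
    · exact isClosed_eq (by fun_prop) continuous_const
    · exact isClosed_iInter fun k => isClosed_le continuous_const (by fun_prop)
  · rintro p ⟨-, h0, h1, -⟩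
    exact ⟨h0, fun i => (Finset.single_le_sum (fun j _ => h0 j) (Finset.mem_univ i)).trans_eq h1⟩

theorem mem_majorizingDensities_iff {d : ℕ} {ρ ρ' V V' : Matrix (Fin d) (Fin d) ℂ}
    {v v' : Fin d → ℝ} (hV : IsSortedDiag ρ V v) (hV' : IsSortedDiag ρ' V' v') :
    ρ' ∈ majorizingDensities ρ ↔
      ∑ i, v' i = 1 ∧ ∀ k : ℕ, ∑ i with i.val < k, v i ≤ ∑ i with i.val < k, v' i := by
  obtain ⟨W, w, hW, hw⟩ := exists_isSortedDiag hV.posSemidef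
  obtain ⟨W', w', hW', hw'⟩ := exists_isSortedDiag hV'.posSemidef
  have htr : ρ'.trace = 1 ↔ ∑ i, v' i = 1 := by
    rw [hV'.trace_eq]
    exact_mod_cast Iff.rfl
  constructor
  · rintro ⟨⟨-, h1⟩, ⟨h', h, hle⟩⟩
    refine ⟨htr.1 h1, fun k => ?_⟩
    have := hle k
    rw [hw, hw'] at this
    exact (hV.partialSum_le hW k).trans (this.trans (hW'.partialSum_le hV' k))
  · rintro ⟨h1, hle⟩
    refine ⟨⟨hV'.posSemidef, htr.2 h1⟩, ⟨hV'.posSemidef.1, hV.posSemidef.1, fun k => ?_⟩⟩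
    rw [hw, hw']
    exact (hW.partialSum_le hV k).trans ((hle k).trans (hV'.partialSum_le hW' k))

theorem norm_trace_sqrt_mul_sqrt_mul_le {d : ℕ} {ρ σ V W U : Matrix (Fin d) (Fin d) ℂ}
    {v w : Fin d → ℝ} (hV : IsSortedDiag ρ V v) (hW : IsSortedDiag σ W w)
    (hU : U ∈ unitaryGroup (Fin d) ℂ) :
    ‖(CFC.sqrt ρ * CFC.sqrt σ * U).trace‖ ≤ ∑ i, √(v i) * √(w i) := by
  have hherm : ∀ τ : Matrix (Fin d) (Fin d) ℂ, (CFC.sqrt τ)ᴴ = CFC.sqrt τ := fun τ =>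
    (Matrix.nonneg_iff_posSemidef.1 (CFC.sqrt_nonneg τ)).1
  have hU1 : Uᴴ * U = 1 := mem_unitaryGroup_iff'.1 hU
  have hU2 : U * Uᴴ = 1 := mem_unitaryGroup_iff.1 hU
  have hM : IsSortedDiag (CFC.sqrt ρ * (CFC.sqrt ρ)ᴴ) V v := by
    rw [hherm, CFC.sqrt_mul_sqrt_self ρ hV.posSemidef.nonneg]
    exact hV
  have hN : IsSortedDiag ((Uᴴ * CFC.sqrt σ) * (Uᴴ * CFC.sqrt σ)ᴴ) (Uᴴ * W) w := by
    refine ⟨?_, ?_, hW.antitone, hW.nonneg, ?_⟩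
    · rw [conjTranspose_mul, conjTranspose_conjTranspose, Matrix.mul_assoc, ← Matrix.mul_assoc U,
        hU2, Matrix.one_mul, hW.left_inv]
    · rw [conjTranspose_mul, conjTranspose_conjTranspose, Matrix.mul_assoc, ← Matrix.mul_assoc W,
        hW.right_inv, Matrix.one_mul, hU1]
    · rw [conjTranspose_mul, hherm, Matrix.mul_assoc, ← Matrix.mul_assoc (CFC.sqrt σ),
        CFC.sqrt_mul_sqrt_self σ hW.posSemidef.nonneg]
      conv_lhs => rw [hW.eq]
      simp only [conjTranspose_mul, Matrix.mul_assoc]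
  have h := norm_trace_conjTranspose_mul_le hM hN
  rwa [conjTranspose_mul, conjTranspose_conjTranspose, hherm, Matrix.trace_mul_comm,
    ← Matrix.mul_assoc] at h

theorem trace_sqrt_mul_sqrt {d : ℕ} {ρ σ W : Matrix (Fin d) (Fin d) ℂ} {p w : Fin d → ℝ}
    (hρ : IsSortedDiag ρ W p) (hσ : IsSortedDiag σ W w) :
    (CFC.sqrt ρ * CFC.sqrt σ).trace = ((∑ i, √(p i) * √(w i) : ℝ) : ℂ) := by
  have h : W * realDiagonal (fun i => √(p i)) * Wᴴ * (W * realDiagonal (fun i => √(w i)) * Wᴴ) =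
      W * (realDiagonal (fun i => √(p i)) * (Wᴴ * W) * realDiagonal (fun i => √(w i)) * Wᴴ) := by
    simp only [Matrix.mul_assoc]
  rw [hρ.sqrt_eq, hσ.sqrt_eq, h, hρ.left_inv, Matrix.mul_one, Matrix.trace_mul_comm,
    Matrix.mul_assoc, hρ.left_inv, Matrix.mul_one, realDiagonal_mul, trace_diagonal,
    Complex.ofReal_sum]

theorem isCompact_unitaryGroup (d : ℕ) :
    IsCompact (unitaryGroup (Fin d) ℂ : Set (Matrix (Fin d) (Fin d) ℂ)) := by
  have hK : IsCompact (Set.univ.pi fun _ : Fin d => Set.univ.pi fun _ : Fin d =>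
      Metric.closedBall (0 : ℂ) 1) :=
    isCompact_univ_pi fun _ => isCompact_univ_pi fun _ => isCompact_closedBall 0 1
  refine IsCompact.of_isClosed_subset (X := Matrix (Fin d) (Fin d) ℂ) hK ?_ ?_
  · have : (unitaryGroup (Fin d) ℂ : Set (Matrix (Fin d) (Fin d) ℂ)) = {U | U * star U = 1} := by
      ext U
      exact mem_unitaryGroup_iff
    rw [this]
    exact isClosed_eq (by fun_prop) continuous_const
  · intro U hU i _ j _
    simpa using entry_norm_bound_of_unitary hU i j

theorem exists_isGreatest_norm_trace_mul_unitary {d : ℕ} (A : Matrix (Fin d) (Fin d) ℂ) :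
    ∃ g : ℝ, IsGreatest {f : ℝ | ∃ U ∈ unitaryGroup (Fin d) ℂ, f = ‖(A * U).trace‖ ^ 2} g := by
  obtain ⟨U, hU, hmax⟩ := (isCompact_unitaryGroup d).exists_isMaxOn ⟨1, one_mem _⟩
    (f := fun U => ‖(A * U).trace‖ ^ 2) (by fun_prop)
  refine ⟨_, ⟨U, hU, rfl⟩, ?_⟩
  rintro _ ⟨U', hU', rfl⟩
  exact hmax hU'

theorem IsMaximallyEntangled.sqrt_reducedDensity {a b L : ℕ} {Ψ : BipVec a b}
    (hL : IsMaximallyEntangled Ψ L) :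
    CFC.sqrt (reducedDensity Ψ) = ((√L : ℝ) : ℂ) • reducedDensity Ψ := by
  obtain ⟨hL0, hproj, -⟩ := hL
  have hLne : (L : ℂ) ≠ 0 := by exact_mod_cast hL0.ne'
  have hsq : (((√L : ℝ) : ℂ)) * ((√L : ℝ) : ℂ) = L := by
    exact_mod_cast Real.mul_self_sqrt (Nat.cast_nonneg L)
  refine CFC.sqrt_unique ?_ ?_
  · have h := hproj.isIdempotentElem.eq
    rw [smul_mul_smul_comm, ← smul_smul] at h
    rw [smul_mul_smul_comm, hsq]
    exact smul_right_injective _ hLne h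
  · refine ((reducedDensity_posSemidef Ψ).smul ?_).nonneg
    exact_mod_cast Real.sqrt_nonneg _

theorem trace_mul_smul_reducedDensity_sq_div {a b L : ℕ} {Ψ : BipVec a b}
    (hL : IsMaximallyEntangled Ψ L) (A : Matrix (Fin a) (Fin a) ℂ) :
    (A * ((L : ℂ) • reducedDensity Ψ)).trace.re ^ 2 / L =
      (A * CFC.sqrt (reducedDensity Ψ)).trace.re ^ 2 := by
  have hL0 : (0 : ℝ) < L := by exact_mod_cast hL.1
  rw [hL.sqrt_reducedDensity, Matrix.mul_smul, Matrix.mul_smul, trace_smul, trace_smul,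
    smul_eq_mul, smul_eq_mul, Complex.re_ofReal_mul, ← Complex.ofReal_natCast,
    Complex.re_ofReal_mul, mul_pow, mul_pow, Real.sq_sqrt hL0.le]
  field_simp

end LOCCFidelity

end

open LOCCFidelity in
theorem mainTheorem4 {dA dB : ℕ} (Φ Ψ : LOCCFidelity.BipVec dA dB) (hΦ : ‖Φ‖ = 1) (hΨ : ‖Ψ‖ = 1)
    (ρ σ : Matrix (Fin dA) (Fin dA) ℂ)
    (hρ : ρ = LOCCFidelity.reducedDensity Φ) (hσ : σ = LOCCFidelity.reducedDensity Ψ) :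
    ∃ F : ℝ,
      -- `F` is the maximum over LOCC operations `C` of `⟨Ψ| C(|Φ⟩⟨Φ|) |Ψ⟩`
      IsGreatest
        {f : ℝ | ∃ C : LOCCFidelity.BipOp dA dB → LOCCFidelity.BipOp dA dB,
          LOCCFidelity.IsLOCC C ∧ f = LOCCFidelity.fidelity Ψ (C (LOCCFidelity.pureState Φ))} F ∧
      -- `F` is the maximum over `ρ' ⪰ ρ` of `g ρ'`, the maximum over unitaries `U`
      (∃ g : Matrix (Fin dA) (Fin dA) ℂ → ℝ,
        (∀ ρ' ∈ LOCCFidelity.majorizingDensities ρ,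
          IsGreatest
            {f : ℝ | ∃ U ∈ Matrix.unitaryGroup (Fin dA) ℂ,
              f = ‖(CFC.sqrt ρ' * CFC.sqrt σ * U).trace‖ ^ 2} (g ρ')) ∧
        IsGreatest (g '' LOCCFidelity.majorizingDensities ρ) F) ∧
      -- the case of a maximally entangled target of size `L`, with `T = L • σ`
      (∀ L : ℕ, LOCCFidelity.IsMaximallyEntangled Ψ L →
        IsGreatest
          {f : ℝ | ∃ ρ' ∈ LOCCFidelity.majorizingDensities ρ,
            f = (CFC.sqrt ρ' * ((L : ℂ) • σ)).trace.re ^ 2 / L} F) := by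
  subst hρ hσ
  obtain ⟨V, v, hV, -⟩ := exists_isSortedDiag (reducedDensity_posSemidef Φ)
  obtain ⟨W, w, hW, -⟩ := exists_isSortedDiag (reducedDensity_posSemidef Ψ)
  have hv1 : ∑ i, v i = 1 := by
    rw [reducedDensity_eq] at hV
    rw [hV.sum_eq_hsSq, hsSq_coeffMatrix, hΦ, one_pow]
  obtain ⟨p, hpP, hpmax⟩ := (isCompact_majorizingVectors v).exists_isMaxOn
    ⟨v, hV.antitone, hV.nonneg, hv1, fun _ => le_rfl⟩
    (f := fun p : Fin dA → ℝ => (∑ i, √(p i) * √(w i)) ^ 2) (by fun_prop)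
  obtain ⟨hpa, hp0, hp1, hpv⟩ := hpP
  set F : ℝ := (∑ i, √(p i) * √(w i)) ^ 2 with hF
  have hmax : ∀ q ∈ majorizingVectors v, (∑ i, √(q i) * √(w i)) ^ 2 ≤ F := fun q hq => hpmax hq
  have hupper : ∀ ρ' ∈ majorizingDensities (reducedDensity Φ),
      ∀ U ∈ Matrix.unitaryGroup (Fin dA) ℂ,
        ‖(CFC.sqrt ρ' * CFC.sqrt (reducedDensity Ψ) * U).trace‖ ^ 2 ≤ F := by
    intro ρ' hρ' U hU
    obtain ⟨V', v', hV', -⟩ := exists_isSortedDiag hρ'.1.1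
    obtain ⟨h1, h2⟩ := (mem_majorizingDensities_iff hV hV').1 hρ'
    exact (pow_le_pow_left₀ (norm_nonneg _) (norm_trace_sqrt_mul_sqrt_mul_le hV' hW hU) 2).trans
      (hmax v' ⟨hV'.antitone, hV'.nonneg, h1, h2⟩)
  set ρo : Matrix (Fin dA) (Fin dA) ℂ := W * realDiagonal p * Wᴴ
  have hρo : IsSortedDiag ρo W p := ⟨hW.left_inv, hW.right_inv, hpa, hp0, rfl⟩
  have hρoM : ρo ∈ majorizingDensities (reducedDensity Φ) :=
    (mem_majorizingDensities_iff hV hρo).2 ⟨hp1, hpv⟩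
  have htr := trace_sqrt_mul_sqrt hρo hW
  refine ⟨F, ⟨?_, ?_⟩, ?_, ?_⟩
  · obtain ⟨C, hC, hle⟩ := exists_isLOCC_le_fidelity Φ Ψ hV hW hp0 (hp1.trans hv1.symm) hpv
    refine ⟨C, hC, le_antisymm hle ?_⟩
    obtain ⟨q, hqa, hq0, hq1, hqv, hq⟩ := hC.exists_fidelity_le Φ Ψ hV hW
    exact hq.trans (hmax q ⟨hqa, hq0, hq1.trans hv1, hqv⟩)
  · rintro _ ⟨C, hC, rfl⟩
    obtain ⟨q, hqa, hq0, hq1, hqv, hq⟩ := hC.exists_fidelity_le Φ Ψ hV hW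
    exact hq.trans (hmax q ⟨hqa, hq0, hq1.trans hv1, hqv⟩)
  · choose g hg using fun ρ' : Matrix (Fin dA) (Fin dA) ℂ =>
      exists_isGreatest_norm_trace_mul_unitary (CFC.sqrt ρ' * CFC.sqrt (reducedDensity Ψ))
    have hgF : ∀ ρ' ∈ majorizingDensities (reducedDensity Φ), g ρ' ≤ F := by
      intro ρ' hρ'
      obtain ⟨U, hU, hgU⟩ := (hg ρ').1
      rw [hgU]
      exact hupper ρ' hρ' U hU
    refine ⟨g, fun ρ' _ => hg ρ', ⟨ρo, hρoM, le_antisymm (hgF ρo hρoM) ?_⟩, ?_⟩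
    · refine (hg ρo).2 ⟨1, one_mem _, ?_⟩
      rw [Matrix.mul_one, htr, Complex.norm_real, Real.norm_eq_abs, sq_abs]
    · rintro _ ⟨ρ', hρ', rfl⟩
      exact hgF ρ' hρ'
  · intro L hL
    have hLtr : ∀ ρ' : Matrix (Fin dA) (Fin dA) ℂ,
        (CFC.sqrt ρ' * ((L : ℂ) • reducedDensity Ψ)).trace.re ^ 2 / L =
          (CFC.sqrt ρ' * CFC.sqrt (reducedDensity Ψ)).trace.re ^ 2 := fun ρ' =>
      trace_mul_smul_reducedDensity_sq_div hL _
    refine ⟨⟨ρo, hρoM, ?_⟩, ?_⟩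
    · rw [hLtr, htr, Complex.ofReal_re]
    · rintro _ ⟨ρ', hρ', rfl⟩
      rw [hLtr]
      have h1 := hupper ρ' hρ' 1 (one_mem _)
      rw [Matrix.mul_one] at h1
      refine le_trans ?_ h1
      rw [← sq_abs]
      exact pow_le_pow_left₀ (abs_nonneg _) (Complex.abs_re_le_norm _) 2
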